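/- For an integer $x$ let $T_x = x(x+1)/2$; the integers of the form $T_x$ with $x\in\mathbb Z$ are called triangular numbers. An even (respectively odd) square is the square of an even (respectively odd) integer, so $0$ is an even square. Let $m$ be a positive integer. (i) Assume that $2m+1$ is a prime congruent to $3$ modulo $4$. Then $T_m$ cannot be written in the form $x^2+y^2+T_z$ with $x,y,z\in\mathbb Z$, $x^2+y^2>0$ and $x\equiv y \pmod 2$. Also, $2T_m$ is not a sum of a positive even square and two triangular numbers. (ii) Suppose that all prime divisors of $2m+1$ are congruent to $1$ modulo $4$. Then $T_m$ cannot be written as a sum of an odd square, an even square and a triangular number. Also, $2T_m$ is not a sum of an odd square and two triangular numbers. -/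

import Mathlib

/-- The triangular number `T_x = x(x+1)/2` for an integer `x`
(the division is exact, since `x(x+1)` is even). -/
def triangular (x : ℤ) : ℤ := x * (x + 1) / 2

/-- The division in the definition of `triangular` is exact. -/
theorem two_mul_triangular (x : ℤ) : 2 * triangular x = x * (x + 1) :=
  Int.mul_ediv_cancel' (Int.even_mul_succ_self x).two_dvd

/-- An integer is a triangular number if it equals `T_x` for some integer `x`. -/
def IsTriangular (t : ℤ) : Prop := ∃ x : ℤ, t = triangular x

/-- An integer is an even square if it is the square of an even integer. -/
def IsEvenSquare (s : ℤ) : Prop := ∃ a : ℤ, Even a ∧ s = a ^ 2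

/-- An integer is an odd square if it is the square of an odd integer. -/
def IsOddSquare (s : ℤ) : Prop := ∃ a : ℤ, Odd a ∧ s = a ^ 2

/-! Put n = 2m + 1. Each representation becomes n² = w² + 4N with N > 0 a sum of two squares, so N =
uv with u + v = n. A prime q ≡ 3 mod 4 dividing both u and v would divide n properly, so u and v are
themselves sums of two squares, hence 0, 1 or 2 mod 4. Then u + v ≡ 3 iff uv ≡ 2 mod 4. But (i) has
n ≡ 3, 4 ∣ N, and (ii) has n ≡ 1, N ≡ 2. -/

/-- If a product of two positive integers is a sum of two squares and no prime congruent to `3`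
modulo `4` divides both factors, then the first factor is a sum of two squares. -/
theorem Nat.eq_sq_add_sq_of_mul {u v x y : ℕ} (hu : u ≠ 0) (hv : v ≠ 0)
    (h : u * v = x ^ 2 + y ^ 2)
    (hq : ∀ q : ℕ, q.Prime → q % 4 = 3 → q ∣ u → ¬ q ∣ v) :
    ∃ a b : ℕ, u = a ^ 2 + b ^ 2 := by
  rw [Nat.eq_sq_add_sq_iff]
  intro q hqu hq3
  have hp := Nat.prime_of_mem_primeFactors hqu
  have hdvd := Nat.dvd_of_mem_primeFactors hqu
  have := Fact.mk hp
  have heven := Nat.eq_sq_add_sq_iff.mp ⟨x, y, h⟩ (q := q)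
    (Nat.mem_primeFactors.mpr ⟨hp, hdvd.mul_right v, mul_ne_zero hu hv⟩) hq3
  rwa [padicValNat.mul hu hv, padicValNat.eq_zero_of_not_dvd (hq q hp hq3 hdvd),
    add_zero] at heven

/-- If `n ^ 2 = w ^ 2 + 4 * (x ^ 2 + y ^ 2)` with `x ^ 2 + y ^ 2 > 0`, and no prime congruent to `3`
modulo `4` properly divides `n`, then the factors `(n - w) / 2` and `(n + w) / 2` of `x ^ 2 + y ^ 2`
are sums of two squares. -/
theorem exists_sq_add_sq_factors {n : ℕ} {w x y : ℤ}
    (hq : ∀ q : ℕ, q.Prime → q % 4 = 3 → q ∣ n → q = n)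
    (hpos : 0 < x ^ 2 + y ^ 2) (h : (n : ℤ) ^ 2 = w ^ 2 + 4 * (x ^ 2 + y ^ 2)) :
    ∃ a b c d : ℤ, (n : ℤ) = (a ^ 2 + b ^ 2) + (c ^ 2 + d ^ 2) ∧
      (a ^ 2 + b ^ 2) * (c ^ 2 + d ^ 2) = x ^ 2 + y ^ 2 := by
  have hpar : Even ((n : ℤ) - w) := by
    have : Even ((n : ℤ) ^ 2 - w ^ 2) := ⟨2 * (x ^ 2 + y ^ 2), by linarith⟩
    simpa [Int.even_sub, Int.even_pow] using this
  obtain ⟨u, hu⟩ := hpar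
  obtain ⟨v, hv⟩ : ∃ v, v = n - u := ⟨_, rfl⟩
  have huv : u * v = x ^ 2 + y ^ 2 := by
    have hw : w = n - 2 * u := by linarith
    subst hw hv
    linarith
  have hsum : u + v = n := by rw [hv]; ring
  have hu0 : 0 < u := by
    by_contra! hle
    have hv0 : 0 ≤ v := by linarith [Int.natCast_nonneg n]
    nlinarith
  have hv0 : 0 < v := pos_of_mul_pos_right (huv ▸ hpos) hu0.le
  lift u to ℕ using hu0.le
  lift v to ℕ using hv0.le
  norm_cast at hu0 hv0 hsum
  have hnat : u * v = x.natAbs ^ 2 + y.natAbs ^ 2 := by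
    zify
    simpa using huv
  have hcop : ∀ q : ℕ, q.Prime → q % 4 = 3 → q ∣ u → ¬ q ∣ v := by
    intro q hp hq3 hqu hqv
    have := hq q hp hq3 (hsum ▸ dvd_add hqu hqv)
    have := Nat.le_of_dvd hu0 hqu
    omega
  obtain ⟨a, b, hab⟩ := Nat.eq_sq_add_sq_of_mul hu0.ne' hv0.ne' hnat hcop
  obtain ⟨c, d, hcd⟩ := Nat.eq_sq_add_sq_of_mul hv0.ne' hu0.ne' ((mul_comm v u).trans hnat)
    fun q hp hq3 hqv hqu => hcop q hp hq3 hqu hqv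
  refine ⟨a, b, c, d, ?_, ?_⟩
  · exact_mod_cast (hab ▸ hcd ▸ hsum.symm)
  · rw [← huv, hab, hcd]
    push_cast
    ring

theorem Int.sq_add_sq_emod_four (a b : ℤ) :
    (a ^ 2 + b ^ 2) % 4 = 0 ∨ (a ^ 2 + b ^ 2) % 4 = 1 ∨ (a ^ 2 + b ^ 2) % 4 = 2 := by
  rcases Int.even_or_odd' a with ⟨k, rfl | rfl⟩ <;> rcases Int.even_or_odd' b with ⟨l, rfl | rfl⟩ <;>
    ring_nf <;> omega

theorem sq_ne_sq_add_sixteen_mul {p : ℕ} (hp : p.Prime) (hp3 : p % 4 = 3) {w a b : ℤ}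
    (hpos : 0 < a ^ 2 + b ^ 2) : (p : ℤ) ^ 2 ≠ w ^ 2 + 16 * (a ^ 2 + b ^ 2) := by
  intro h
  obtain ⟨c, d, e, f, hsum, hmul⟩ := exists_sq_add_sq_factors (n := p) (w := w)
    (x := 2 * a) (y := 2 * b) (fun q hq _ hdvd => (Nat.prime_dvd_prime_iff_eq hq hp).mp hdvd)
    (by linarith) (by linarith)
  have h4 : (c ^ 2 + d ^ 2) * (e ^ 2 + f ^ 2) % 4 = 0 := by
    rw [hmul]
    ring_nf
    omega
  rw [Int.mul_emod] at h4
  rcases Int.sq_add_sq_emod_four c d with h1 | h1 | h1 <;>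
    rcases Int.sq_add_sq_emod_four e f with h2 | h2 | h2 <;>
    rw [h1, h2] at h4 <;> omega

theorem mod_four_eq_one_of_primeFactors {n : ℕ} (hn : n ≠ 0)
    (hq : ∀ q : ℕ, q.Prime → q ∣ n → q ≡ 1 [MOD 4]) : n ≡ 1 [MOD 4] := by
  induction n using Nat.recOnMul with
  | zero => exact absurd rfl hn
  | one => rfl
  | prime p hp => exact hq p hp dvd_rfl
  | mul a b iha ihb =>
    exact (iha (left_ne_zero_of_mul hn) fun q hp hd => hq q hp (hd.mul_right b)).mul
      (ihb (right_ne_zero_of_mul hn) fun q hp hd => hq q hp (hd.mul_left a))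

theorem sq_ne_sq_add_eight_mul {n : ℕ} (hn : n ≠ 0)
    (hq : ∀ q : ℕ, q.Prime → q ∣ n → q ≡ 1 [MOD 4]) {w x y : ℤ} (hodd : Odd (x + y)) :
    (n : ℤ) ^ 2 ≠ w ^ 2 + 8 * (x ^ 2 + y ^ 2) := by
  intro h
  have hn1 : n % 4 = 1 := mod_four_eq_one_of_primeFactors hn hq
  have hNodd : (x ^ 2 + y ^ 2) % 2 = 1 := by
    rw [← Int.odd_iff]
    simpa [Int.odd_add, Int.odd_pow, Int.even_pow] using hodd
  have hNpos : 0 < x ^ 2 + y ^ 2 := by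
    have : 0 ≤ x ^ 2 + y ^ 2 := by positivity
    omega
  -- 2(x² + y²) = (x + y)² + (x - y)².
  obtain ⟨c, d, e, f, hsum, hmul⟩ := exists_sq_add_sq_factors (n := n) (w := w)
    (x := x + y) (y := x - y)
    (fun q hp h3 hdvd => by have := hq q hp hdvd; rw [Nat.ModEq] at this; omega)
    (by linarith) (by linarith)
  have h4 : (c ^ 2 + d ^ 2) * (e ^ 2 + f ^ 2) % 4 = 2 := by
    have : (c ^ 2 + d ^ 2) * (e ^ 2 + f ^ 2) = 2 * (x ^ 2 + y ^ 2) := by rw [hmul]; ring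
    omega
  rw [Int.mul_emod] at h4
  rcases Int.sq_add_sq_emod_four c d with h1 | h1 | h1 <;>
    rcases Int.sq_add_sq_emod_four e f with h2 | h2 | h2 <;>
    rw [h1, h2] at h4 <;> omega

/-- A relation `2 * T_m = s + T_t + T_u` yields a representation of `(2 * m + 1) ^ 2` as
`4 * s` plus an odd square plus an even square. -/
theorem exists_odd_sq_add_even_sq {m s t u : ℤ}
    (h : 2 * triangular m = s + triangular t + triangular u) :
    ∃ w b : ℤ, Odd w ∧ (2 * m + 1) ^ 2 = w ^ 2 + 4 * (s + b ^ 2) := by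
  have hm := two_mul_triangular m
  have ht := two_mul_triangular t
  have hu := two_mul_triangular u
  -- 4T_t + 4T_u + 1 = (t + u + 1)² + (t - u)², whose bases have opposite parity.
  rcases Int.even_or_odd' (t - u) with ⟨k, hk | hk⟩
  · obtain rfl : t = u + 2 * k := by linarith
    exact ⟨2 * (u + k) + 1, k, odd_two_mul_add_one _, by linarith⟩
  · obtain rfl : t = u + 2 * k + 1 := by linarith
    exact ⟨2 * k + 1, u + k + 1, odd_two_mul_add_one _, by linarith⟩

theorem Int.sq_emod_eight_of_odd {w : ℤ} (hw : Odd w) : w ^ 2 % 8 = 1 := by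
  obtain ⟨k, rfl⟩ := hw
  obtain ⟨j, hj⟩ := Int.even_mul_succ_self k
  have : (2 * k + 1) ^ 2 = 8 * j + 1 := by linarith
  omega

theorem theorem2p1 (m : ℕ) (hm : 1 ≤ m) :
    (Nat.Prime (2 * m + 1) → 2 * m + 1 ≡ 3 [MOD 4] →
      (¬ ∃ x y z : ℤ, x ≡ y [ZMOD 2] ∧ 0 < x ^ 2 + y ^ 2 ∧
          triangular m = x ^ 2 + y ^ 2 + triangular z) ∧
      (¬ ∃ s t u : ℤ, IsEvenSquare s ∧ 0 < s ∧ IsTriangular t ∧ IsTriangular u ∧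
          2 * triangular m = s + t + u)) ∧
    ((∀ q : ℕ, Nat.Prime q → q ∣ 2 * m + 1 → q ≡ 1 [MOD 4]) →
      (¬ ∃ s s' t : ℤ, IsOddSquare s ∧ IsEvenSquare s' ∧ IsTriangular t ∧
          triangular m = s + s' + t) ∧
      (¬ ∃ s t u : ℤ, IsOddSquare s ∧ IsTriangular t ∧ IsTriangular u ∧
          2 * triangular m = s + t + u)) := by
  have hTm := two_mul_triangular m
  have hsq : ((2 * (m : ℤ) + 1) ^ 2) % 8 = 1 := Int.sq_emod_eight_of_odd
    (odd_two_mul_add_one (m : ℤ))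
  refine ⟨fun hp h3 => ⟨?_, ?_⟩, fun hq => ⟨?_, ?_⟩⟩
  · rintro ⟨x, y, z, hxy, hpos, h⟩
    have hTz := two_mul_triangular z
    obtain ⟨k, hk⟩ := hxy.dvd
    obtain rfl : y = x + 2 * k := by linarith
    -- x² + (x + 2k)² = 2((x + k)² + k²).
    refine sq_ne_sq_add_sixteen_mul hp h3 (w := 2 * z + 1) (a := x + k) (b := k) (by linarith) ?_
    push_cast
    linarith
  · rintro ⟨s, t, u, ⟨c, ⟨e, rfl⟩, rfl⟩, hpos, ⟨t, rfl⟩, ⟨u, rfl⟩, h⟩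
    obtain ⟨w, b, hw, hwb⟩ := exists_odd_sq_add_even_sq h
    have hw8 := Int.sq_emod_eight_of_odd hw
    obtain ⟨l, rfl | rfl⟩ := Int.even_or_odd' b
    · refine sq_ne_sq_add_sixteen_mul hp h3 (w := w) (a := e) (b := l)
        (by linarith [sq_nonneg l]) ?_
      push_cast
      linarith
    -- Odd squares are 1 mod 8, so s + b² is even; here it is odd.
    · ring_nf at hwb hsq
      omega
  · rintro ⟨_, _, _, ⟨x, hx, rfl⟩, ⟨y, hy, rfl⟩, ⟨z, rfl⟩, h⟩
    have hTz := two_mul_triangular z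
    refine sq_ne_sq_add_eight_mul (Nat.succ_ne_zero _) hq (w := 2 * z + 1) (hx.add_even hy) ?_
    push_cast
    linarith
  · rintro ⟨_, _, _, ⟨c, ⟨e, rfl⟩, rfl⟩, ⟨t, rfl⟩, ⟨u, rfl⟩, h⟩
    obtain ⟨w, b, hw, hwb⟩ := exists_odd_sq_add_even_sq h
    have hw8 := Int.sq_emod_eight_of_odd hw
    obtain ⟨l, rfl | rfl⟩ := Int.even_or_odd' b
    · ring_nf at hwb hsq
      omega
    -- (2e + 1)² + (2l + 1)² = 2((e + l + 1)² + (e - l)²).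
    · refine sq_ne_sq_add_eight_mul (Nat.succ_ne_zero _) hq (w := w) (x := e + l + 1)
        (y := e - l) ⟨e, by ring⟩ ?_
      push_cast
      linarith
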